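/- Let $\phi=\frac{1+\sqrt5}{2}$, and let $r_0,\dots,r_4\in GL_5(\mathbb R)$, acting on coordinates $(x_0,\dots,x_4)$, be the following Lorentz reflections for the form $-x_0^2+x_1^2+x_2^2+x_3^2+x_4^2$: $r_0$ negates $x_1$; for $k=1,2,3$, $r_k$ exchanges $x_k$ and $x_{k+1}$; and $r_4$ sends $(x_0,x_1,x_2,x_3,x_4)$ to $(\phi x_0-\sqrt\phi\,x_4,\,x_1,\,x_2,\,x_3,\,\sqrt\phi\,x_0-\phi x_4)$. Let $\Gamma=\langle r_0,\dots,r_4\rangle$ and $S_i=\langle r_j : j\neq i\rangle$. The $\{4,3,3,5\}$ tessellation of hyperbolic $4$-space $\mathbb H^4$ by hypercubes is described by the cosets of $\Gamma$: its $i$-faces are the left cosets of $S_i$ in $\Gamma$ ($0\le i\le 4$), and two faces are incident if the corresponding cosets intersect. In particular its vertices are the cosets of $S_0$, its edges are the cosets of $S_1$, and two distinct vertices are adjacent if some edge is incident to both. A path of edges of length $\ell$ is a sequence $v_0,\dots,v_\ell$ of vertices in which consecutive vertices are adjacent; a subpath is a sequence $v_i,v_{i+1},\dots,v_j$ with $0\le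 i\le j\le\ell$; the path is minimal if no path of edges from $v_0$ to $v_\ell$ is shorter. A loop of edges is a path of edges of positive length with $v_0=v_\ell$. Lemma. In the $\{4,3,3,5\}$ tessellation of $\mathbb H^4$, every loop of edges has at least one subpath of length at most $8$ which is not minimal. -/

import Mathlib

/-! The regular tessellation `{4,3,3,5}` of hyperbolic 4-space by hypercubes, given by the cosets of
its symmetry group, a group of Lorentz matrices acting on the hyperboloid model. -/

namespace Tess4335

open Matrix

/-- The five Lorentz reflections generating the symmetry group of the tessellation `{4,3,3,5}`
(coordinate `0` is the time coordinate, and `φ` is the golden ratio). They are the reflections in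
the walls of a fundamental simplex; the first four generate the symmetry group of a hypercube
centred at the origin `(1,0,0,0,0)` of the hyperboloid model. -/
noncomputable def refl : Fin 5 → Matrix (Fin 5) (Fin 5) ℝ
  | 0 => !![1, 0, 0, 0, 0;
            0, -1, 0, 0, 0;
            0, 0, 1, 0, 0;
            0, 0, 0, 1, 0;
            0, 0, 0, 0, 1]
  | 1 => !![1, 0, 0, 0, 0;
            0, 0, 1, 0, 0;
            0, 1, 0, 0, 0;
            0, 0, 0, 1, 0;
            0, 0, 0, 0, 1]
  | 2 => !![1, 0, 0, 0, 0;
            0, 1, 0, 0, 0;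
            0, 0, 0, 1, 0;
            0, 0, 1, 0, 0;
            0, 0, 0, 0, 1]
  | 3 => !![1, 0, 0, 0, 0;
            0, 1, 0, 0, 0;
            0, 0, 1, 0, 0;
            0, 0, 0, 0, 1;
            0, 0, 0, 1, 0]
  | 4 => !![Real.goldenRatio, 0, 0, 0, -√Real.goldenRatio;
            0, 1, 0, 0, 0;
            0, 0, 1, 0, 0;
            0, 0, 0, 1, 0;
            √Real.goldenRatio, 0, 0, 0, -Real.goldenRatio]

set_option maxHeartbeats 2000000 in
theorem refl_mul_self (i : Fin 5) : refl i * refl i = 1 := by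
  have h1 : Real.goldenRatio * Real.goldenRatio = Real.goldenRatio + 1 := by
    have := Real.goldenRatio_sq
    rwa [sq] at this
  have h2 : √Real.goldenRatio * √Real.goldenRatio = Real.goldenRatio :=
    Real.mul_self_sqrt Real.goldenRatio_pos.le
  fin_cases i <;>
    simp only [refl] <;>
    generalize √Real.goldenRatio = s at h2 ⊢ <;>
    generalize Real.goldenRatio = f at h1 h2 ⊢ <;>
    (ext a b; fin_cases a <;> fin_cases b <;>
      simp [Matrix.mul_apply, Fin.sum_univ_five, h1, h2, mul_comm])

/-- The reflections as invertible matrices. -/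
noncomputable def gen (i : Fin 5) : GL (Fin 5) ℝ :=
  ⟨refl i, refl i, refl_mul_self i, refl_mul_self i⟩

/-- The symmetry group of the tessellation, generated by the five reflections. -/
def Gam : Subgroup (GL (Fin 5) ℝ) := Subgroup.closure (Set.range gen)

/-- The subgroup of `Gam` generated by the four reflections `gen j` with `j ≠ i`:
the stabilizer of the `i`-face of the base flag. -/
def faceStab (i : Fin 5) : Subgroup Gam :=
  (Subgroup.closure (gen '' {j | j ≠ i})).subgroupOf Gam

/-- The `i`-faces of the tessellation are the left cosets of `faceStab i`: vertices for `i = 0`,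
edges for `i = 1`, squares, cubes, and hypercubes for `i = 4`. -/
abbrev Face (i : Fin 5) : Type := Gam ⧸ faceStab i

/-- Two faces are incident if the corresponding cosets have a common element. -/
def Incident {i j : Fin 5} (a : Face i) (b : Face j) : Prop :=
  ∃ g : Gam, (QuotientGroup.mk g : Face i) = a ∧ (QuotientGroup.mk g : Face j) = b

/-- The graph of vertices and edges of the tessellation: two distinct vertices are adjacent
if some edge of the tessellation is incident to both. -/
def edgeGraph : SimpleGraph (Face 0) where
  Adj u v := u ≠ v ∧ ∃ e : Face 1, Incident u e ∧ Incident v e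
  symm := ⟨fun _ _ h => ⟨h.1.symm, h.2.imp fun _ he => ⟨he.2, he.1⟩⟩⟩
  loopless := ⟨fun _ h => h.1 rfl⟩

/-- A path of edges is minimal if no path of edges with the same endpoints is shorter. -/
def IsMinimal {u v : Face 0} (p : edgeGraph.Walk u v) : Prop :=
  ∀ q : edgeGraph.Walk u v, p.length ≤ q.length

end Tess4335

/-! The tessellation `{4,3,3,5}` is a cube complex whose hyperplanes are genuine mirrors: every edge
`u v` is bisected by the mirror of a reflection in the symmetry group, and this reflection exchanges
`u` and `v`. A path which crosses a mirror twice is shortened by reflecting the part in between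
(`exists_shorter_walk`). So it is enough to show that a path, in which any eight consecutive edges
cross different mirrors, is not closed (`IsLocalPath.not_closed`).

Two facts about the mirrors come from arithmetic. In suitable coordinates the symmetry group
preserves a lattice over `ℤ[φ]`, and the conjugate of the Lorentz form is positive definite. Hence
the Lorentz product of the unit normals of two different mirrors has conjugate less than one in
absolute value, and being an element of `ℤ[φ]` it is zero or greater than one in absolute value: the
mirrors are orthogonal or disjoint (`root_trichotomy`). Likewise, the product of a vertex and a unit
normal is odd in `ℤ[φ]` with a small conjugate, so it is at least one in absolute value
(`one_le_abs_lor`); thus no vertex lies on a mirror, and an edge crosses only the mirror which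
bisects it. Moreover, at most four mirrors are pairwise orthogonal, by the signature of the form.

The heart of the proof is `IsLocalPath.orthogonal_of_consecutive_crossings`: between two consecutive
crossings of a mirror `h`, the path crosses only mirrors orthogonal to `h`. If not, then there is a
first edge which leaves the layer along `h`, across a mirror `p` disjoint from `h`. By induction on
the length, the next seven edges are orthogonal to `p`, and none of them leads back towards `h`. At
most three of them are orthogonal to `h`, since these are pairwise orthogonal, and at most three of
them lead away from `h`, since these are pairwise orthogonal as well. But there are seven of them.

In a closed path each mirror is crossed again. Therefore the first five mirrors are pairwise
orthogonal, and five pairwise orthogonal mirrors do not exist. -/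

namespace Tess4335

open Matrix Real

/-! ### The Lorentz form -/

/-- The Lorentz form `-x₀y₀ + x₁y₁ + x₂y₂ + x₃y₃ + x₄y₄`. -/
def lor (x y : Fin 5 → ℝ) : ℝ :=
  -(x 0 * y 0) + x 1 * y 1 + x 2 * y 2 + x 3 * y 3 + x 4 * y 4

theorem lor_comm (x y : Fin 5 → ℝ) : lor x y = lor y x := by
  simp only [lor]; ring

theorem lor_add_left (x y z : Fin 5 → ℝ) : lor (x + y) z = lor x z + lor y z := by
  simp only [lor, Pi.add_apply]; ring

theorem lor_sub_left (x y z : Fin 5 → ℝ) : lor (x - y) z = lor x z - lor y z := by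
  simp only [lor, Pi.sub_apply]; ring

theorem lor_neg_left (x y : Fin 5 → ℝ) : lor (-x) y = -lor x y := by
  simp only [lor, Pi.neg_apply]; ring

theorem lor_smul_left (c : ℝ) (x y : Fin 5 → ℝ) : lor (c • x) y = c * lor x y := by
  simp only [lor, Pi.smul_apply, smul_eq_mul]; ring

theorem lor_add_right (x y z : Fin 5 → ℝ) : lor x (y + z) = lor x y + lor x z := by
  simp only [lor, Pi.add_apply]; ring

theorem lor_sub_right (x y z : Fin 5 → ℝ) : lor x (y - z) = lor x y - lor x z := by
  simp only [lor, Pi.sub_apply]; ring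

theorem lor_neg_right (x y : Fin 5 → ℝ) : lor x (-y) = -lor x y := by
  simp only [lor, Pi.neg_apply]; ring

/-- Future timelike vectors: the open cone over the hyperboloid model of `ℍ⁴`. -/
def IsFuture (x : Fin 5 → ℝ) : Prop := lor x x < 0 ∧ 0 < x 0

theorem IsFuture.lor_lt_zero {x u : Fin 5 → ℝ} (hx : IsFuture x) (hu : IsFuture u) :
    lor x u < 0 := by
  obtain ⟨hx, hx0⟩ := hx
  obtain ⟨hu, hu0⟩ := hu
  simp only [lor] at hx hu ⊢
  set X := x 1 * x 1 + x 2 * x 2 + x 3 * x 3 + x 4 * x 4 with hX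
  set U := u 1 * u 1 + u 2 * u 2 + u 3 * u 3 + u 4 * u 4 with hU
  set I := x 1 * u 1 + x 2 * u 2 + x 3 * u 3 + x 4 * u 4 with hI
  have hcs : I ^ 2 ≤ X * U := by
    have : X * U - I ^ 2 = (x 1 * u 2 - x 2 * u 1) ^ 2 + (x 1 * u 3 - x 3 * u 1) ^ 2
        + (x 1 * u 4 - x 4 * u 1) ^ 2 + (x 2 * u 3 - x 3 * u 2) ^ 2
        + (x 2 * u 4 - x 4 * u 2) ^ 2 + (x 3 * u 4 - x 4 * u 3) ^ 2 := by
      rw [hX, hU, hI]; ring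
    have h : 0 ≤ X * U - I ^ 2 := by rw [this]; positivity
    linarith
  have hX0 : 0 ≤ X := by
    rw [hX]; nlinarith [mul_self_nonneg (x 1), mul_self_nonneg (x 2), mul_self_nonneg (x 3),
      mul_self_nonneg (x 4)]
  have hU0 : 0 ≤ U := by
    rw [hU]; nlinarith [mul_self_nonneg (u 1), mul_self_nonneg (u 2), mul_self_nonneg (u 3),
      mul_self_nonneg (u 4)]
  have hXU : X * U < (x 0 * u 0) ^ 2 := by
    have h1 : X < x 0 * x 0 := by linarith
    have h2 : U < u 0 * u 0 := by linarith
    calc X * U < (x 0 * x 0) * (u 0 * u 0) := mul_lt_mul'' h1 h2 hX0 hU0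
      _ = (x 0 * u 0) ^ 2 := by ring
  have hlt : I < x 0 * u 0 := lt_of_pow_lt_pow_left₀ 2 (by positivity) (by linarith)
  linarith

theorem isFuture_or_isFuture_neg {u : Fin 5 → ℝ} (hu : lor u u < 0) :
    IsFuture u ∨ IsFuture (-u) := by
  rcases lt_trichotomy (u 0) 0 with h0 | h0 | h0
  · exact Or.inr ⟨by rwa [lor_neg_left, lor_neg_right, neg_neg], neg_pos.2 h0⟩
  · simp only [lor, h0] at hu
    nlinarith [mul_self_nonneg (u 1), mul_self_nonneg (u 2), mul_self_nonneg (u 3),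
      mul_self_nonneg (u 4)]
  · exact Or.inl ⟨hu, h0⟩

/-- A timelike vector pairs with all future timelike vectors with the same nonzero sign. -/
theorem IsFuture.lor_mul_lor_pos {x y u : Fin 5 → ℝ} (hx : IsFuture x) (hy : IsFuture y)
    (hu : lor u u < 0) : 0 < lor x u * lor y u := by
  rcases isFuture_or_isFuture_neg hu with h | h
  · exact mul_pos_of_neg_of_neg (hx.lor_lt_zero h) (hy.lor_lt_zero h)
  · have h1 := hx.lor_lt_zero h
    have h2 := hy.lor_lt_zero h
    rw [lor_neg_right] at h1 h2
    nlinarith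

theorem lor_ne_zero_of_timelike {u v : Fin 5 → ℝ} (hu : lor u u < 0) (hv : lor v v < 0) :
    lor u v ≠ 0 := by
  rcases isFuture_or_isFuture_neg hu with h | h
  · exact left_ne_zero_of_mul (h.lor_mul_lor_pos h hv).ne'
  · have := left_ne_zero_of_mul (h.lor_mul_lor_pos h hv).ne'
    rwa [lor_neg_left, neg_ne_zero] at this

/-- There are no five orthonormal vectors for the Lorentz form: their matrix `N` would satisfy
`N J Nᵀ = 1` with `det J = -1`. -/
theorem not_orthonormal_five (n : Fin 5 → Fin 5 → ℝ) :
    ¬ ∀ i j, lor (n i) (n j) = if i = j then 1 else 0 := by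
  intro h
  let J : Matrix (Fin 5) (Fin 5) ℝ := diagonal ![-1, 1, 1, 1, 1]
  have hN : (of n) * J * (of n)ᵀ = 1 := by
    ext i j
    rw [Matrix.one_apply, ← h i j]
    simp [J, Matrix.mul_apply, Matrix.diagonal_apply, lor, Fin.sum_univ_five]
  have hdet := congrArg Matrix.det hN
  have hJ : J.det = -1 := by simp [J, Fin.prod_univ_five]
  rw [det_mul, det_mul, det_transpose, hJ, det_one] at hdet
  nlinarith [mul_self_nonneg (of n).det]

/-! ### The symmetry group -/

theorem gen_inv (i : Fin 5) : (gen i)⁻¹ = gen i := rfl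

theorem gen_mem_Gam (i : Fin 5) : gen i ∈ Gam := Subgroup.subset_closure ⟨i, rfl⟩

theorem sqrt_goldenRatio_mul_self : √goldenRatio * √goldenRatio = goldenRatio :=
  Real.mul_self_sqrt goldenRatio_pos.le

theorem Gam_induction {P : GL (Fin 5) ℝ → Prop} (one : P 1)
    (gen_mul : ∀ i g, P g → P (gen i * g)) {g : GL (Fin 5) ℝ} (hg : g ∈ Gam) : P g := by
  refine Subgroup.closure_induction_left (p := fun g _ => P g) one ?_ ?_ hg
  · rintro _ ⟨i, rfl⟩ y _ hy
    exact gen_mul i y hy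
  · rintro _ ⟨i, rfl⟩ y _ hy
    rw [gen_inv]
    exact gen_mul i y hy

theorem lor_refl_mulVec (i : Fin 5) (x y : Fin 5 → ℝ) :
    lor (refl i *ᵥ x) (refl i *ᵥ y) = lor x y := by
  have h1 : goldenRatio * goldenRatio = goldenRatio + 1 := by rw [← sq, goldenRatio_sq]
  have h2 := sqrt_goldenRatio_mul_self
  fin_cases i <;>
    simp only [refl, lor, mulVec, dotProduct, Fin.sum_univ_five] <;>
    generalize √goldenRatio = s at h2 ⊢ <;> simp <;> try ring1
  linear_combination (-(x 0 * y 0) + x 4 * y 4) * (h1 - h2)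

theorem lor_mulVec {g : GL (Fin 5) ℝ} (hg : g ∈ Gam) (x y : Fin 5 → ℝ) :
    lor (g.1 *ᵥ x) (g.1 *ᵥ y) = lor x y := by
  revert x y
  refine Gam_induction (P := fun g => ∀ x y, lor (g.1 *ᵥ x) (g.1 *ᵥ y) = lor x y) ?_ ?_ hg
  · simp
  · intro i g ih x y
    rw [Units.val_mul, ← mulVec_mulVec, ← mulVec_mulVec]
    exact (lor_refl_mulVec i _ _).trans (ih x y)

theorem isFuture_refl_mulVec (i : Fin 5) {x : Fin 5 → ℝ} (hx : IsFuture x) :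
    IsFuture (refl i *ᵥ x) := by
  refine ⟨by rw [lor_refl_mulVec]; exact hx.1, ?_⟩
  obtain ⟨hx, hx0⟩ := hx
  have h4 : |x 4| < x 0 := by
    refine abs_lt_of_sq_lt_sq ?_ hx0.le
    simp only [lor] at hx
    nlinarith [mul_self_nonneg (x 1), mul_self_nonneg (x 2), mul_self_nonneg (x 3)]
  have hs : √goldenRatio < goldenRatio := by
    rw [Real.sqrt_lt' goldenRatio_pos, goldenRatio_sq]; linarith
  have hs0 : 0 < √goldenRatio := Real.sqrt_pos.2 goldenRatio_pos
  fin_cases i <;> simp only [refl, mulVec, dotProduct, Fin.sum_univ_five] <;>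
    generalize √goldenRatio = s at hs hs0 ⊢ <;> simp <;> try exact hx0
  nlinarith [le_abs_self (x 4), mul_lt_mul'' hs h4 hs0.le (abs_nonneg _)]

theorem isFuture_mulVec {g : GL (Fin 5) ℝ} (hg : g ∈ Gam) {x : Fin 5 → ℝ} (hx : IsFuture x) :
    IsFuture (g.1 *ᵥ x) := by
  refine Gam_induction (P := fun g => IsFuture (g.1 *ᵥ x)) (by simpa using hx) ?_ hg
  intro i g ih
  rw [Units.val_mul, ← mulVec_mulVec]
  exact isFuture_refl_mulVec i ih

/-- The vertex of the tessellation fixed by `gen 1`, …, `gen 4`, scaled to have coordinates in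
the lattice of `latticeVec`. -/
noncomputable def baseVertex : Fin 5 → ℝ := ![√goldenRatio * goldenRatio, 1, 1, 1, 1]

/-- The unit normal of the mirror of `gen 0`, which bisects an edge at `baseVertex`. -/
def baseRoot : Fin 5 → ℝ := ![0, 1, 0, 0, 0]

/-- The points representing vertices of the tessellation. -/
def vertexPoints : Set (Fin 5 → ℝ) := {x | ∃ g ∈ Gam, x = g.1 *ᵥ baseVertex}

/-- The unit normals of the mirrors which bisect edges of the tessellation. Such a mirror is
called a hyperplane below. -/
def roots : Set (Fin 5 → ℝ) := {r | ∃ g ∈ Gam, r = g.1 *ᵥ baseRoot}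

theorem isFuture_baseVertex : IsFuture baseVertex := by
  have h1 := goldenRatio_sq
  have h2 := sqrt_goldenRatio_mul_self
  have h3 := one_lt_goldenRatio
  constructor
  · have : lor baseVertex baseVertex = 3 - 2 * goldenRatio := by
      simp only [lor, baseVertex]
      generalize √goldenRatio = s at h2 ⊢
      simp
      linear_combination -goldenRatio ^ 2 * h2 - (goldenRatio + 1) * h1
    rw [this]
    nlinarith
  · simp only [baseVertex, Matrix.cons_val_zero]
    have := Real.sqrt_pos.2 goldenRatio_pos
    positivity

theorem isFuture_of_mem_vertexPoints {x : Fin 5 → ℝ} (hx : x ∈ vertexPoints) : IsFuture x := by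
  obtain ⟨g, hg, rfl⟩ := hx
  exact isFuture_mulVec hg isFuture_baseVertex

theorem lor_self_of_mem_roots {r : Fin 5 → ℝ} (hr : r ∈ roots) : lor r r = 1 := by
  obtain ⟨g, hg, rfl⟩ := hr
  rw [lor_mulVec hg]
  simp [lor, baseRoot]

theorem inv_mulVec_mem_roots {g : GL (Fin 5) ℝ} (hg : g ∈ Gam) {r : Fin 5 → ℝ} (hr : r ∈ roots) :
    g⁻¹.1 *ᵥ r ∈ roots := by
  obtain ⟨k, hk, rfl⟩ := hr
  exact ⟨g⁻¹ * k, mul_mem (inv_mem hg) hk, by rw [Units.val_mul, mulVec_mulVec]⟩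

theorem mulVec_inv_mulVec (g : GL (Fin 5) ℝ) (x : Fin 5 → ℝ) : g.1 *ᵥ (g⁻¹.1 *ᵥ x) = x := by
  rw [mulVec_mulVec, ← Units.val_mul, mul_inv_cancel, Units.val_one, one_mulVec]

theorem lor_mulVec_left {g : GL (Fin 5) ℝ} (hg : g ∈ Gam) (x y : Fin 5 → ℝ) :
    lor (g.1 *ᵥ x) y = lor x (g⁻¹.1 *ᵥ y) := by
  rw [← lor_mulVec hg x (g⁻¹.1 *ᵥ y), mulVec_inv_mulVec]

/-! ### Arithmetic of the lattice over `ℤ[φ]` -/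

/-- The ring `ℤ[φ]`, with `φ² = 1 + φ`. -/
abbrev GoldenInt : Type := QuadraticAlgebra ℤ 1 1

/-- The real embedding of `ℤ[φ]` which sends the generator to the golden ratio. -/
noncomputable def toReal : GoldenInt →ₐ[ℤ] ℝ :=
  QuadraticAlgebra.lift ⟨goldenRatio, by
    rw [← sq, goldenRatio_sq, one_smul, one_smul, add_comm]⟩

/-- The other real embedding of `ℤ[φ]`. -/
noncomputable def toRealConj : GoldenInt →ₐ[ℤ] ℝ :=
  QuadraticAlgebra.lift ⟨goldenConj, by
    rw [← sq, goldenConj_sq, one_smul, one_smul, add_comm]⟩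

theorem toReal_apply (z : GoldenInt) : toReal z = z.re + z.im * goldenRatio := by
  simp [toReal, QuadraticAlgebra.lift]

theorem toRealConj_apply (z : GoldenInt) : toRealConj z = z.re + z.im * goldenConj := by
  simp [toRealConj, QuadraticAlgebra.lift]

/-- The generator of `ℤ[φ]`. -/
def gold : GoldenInt := QuadraticAlgebra.omega

theorem gold_mul_self : gold * gold = gold + 1 := by
  rw [gold, QuadraticAlgebra.omega_mul_omega_eq_add]
  simp [add_comm]

theorem toReal_gold : toReal gold = goldenRatio := by
  simp [toReal_apply, gold]

theorem toRealConj_gold : toRealConj gold = goldenConj := by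
  simp [toRealConj_apply, gold]

theorem toRealConj_injective : Function.Injective toRealConj := by
  rw [injective_iff_map_eq_zero]
  intro z hz
  rw [toRealConj_apply] at hz
  have him : z.im = 0 := by
    by_contra h
    exact ((goldenConj_irrational.intCast_mul h).intCast_add z.re).ne_zero hz
  have hre : z.re = 0 := by
    rw [him] at hz
    exact_mod_cast (by simpa using hz : (z.re : ℝ) = 0)
  exact QuadraticAlgebra.ext hre him

theorem toReal_injective : Function.Injective toReal := by
  rw [injective_iff_map_eq_zero]
  intro z hz
  rw [toReal_apply] at hz
  have him : z.im = 0 := by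
    by_contra h
    exact ((goldenRatio_irrational.intCast_mul h).intCast_add z.re).ne_zero hz
  have hre : z.re = 0 := by
    rw [him] at hz
    exact_mod_cast (by simpa using hz : (z.re : ℝ) = 0)
  exact QuadraticAlgebra.ext hre him

/-- The norm of a nonzero element of `ℤ[φ]` is a nonzero integer. -/
theorem one_le_abs_toReal_mul_abs_toRealConj {z : GoldenInt} (hz : z ≠ 0) :
    1 ≤ |toReal z| * |toRealConj z| := by
  have h : toReal z * toRealConj z = ((z.re ^ 2 + z.re * z.im - z.im ^ 2 : ℤ) : ℝ) := by
    rw [toReal_apply, toRealConj_apply]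
    push_cast
    linear_combination (z.im : ℝ) ^ 2 * goldenRatio_mul_goldenConj
      + (z.re : ℝ) * z.im * goldenRatio_add_goldenConj
  have h0 : toReal z * toRealConj z ≠ 0 :=
    mul_ne_zero (by simpa using toReal_injective.ne hz) (by simpa using toRealConj_injective.ne hz)
  rw [← abs_mul, h, ← Int.cast_abs]
  rw [h] at h0
  exact_mod_cast Int.one_le_abs (by exact_mod_cast h0)

/-- The vector with coordinates `√φ c₀, c₁, c₂, c₃, c₄`. These vectors form a lattice preserved by
the symmetry group: the factor `√φ` cancels the square roots in `refl 4`. -/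
noncomputable def latticeVec (c : Fin 5 → GoldenInt) : Fin 5 → ℝ :=
  ![√goldenRatio * toReal (c 0), toReal (c 1), toReal (c 2), toReal (c 3), toReal (c 4)]

/-- The Lorentz norm in lattice coordinates. Under the other embedding of `ℤ[φ]`, where `φ` becomes
negative, this form is positive definite. -/
def latticeNorm (c : Fin 5 → GoldenInt) : GoldenInt :=
  -gold * c 0 ^ 2 + c 1 ^ 2 + c 2 ^ 2 + c 3 ^ 2 + c 4 ^ 2

theorem refl_mulVec_latticeVec (i : Fin 5) (c : Fin 5 → GoldenInt) :
    ∃ d, refl i *ᵥ latticeVec c = latticeVec d ∧ latticeNorm d = latticeNorm c := by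
  have h2 := sqrt_goldenRatio_mul_self
  have key : ∀ d : Fin 5 → GoldenInt, (∀ k, (refl i *ᵥ latticeVec c) k = latticeVec d k) →
      latticeNorm d = latticeNorm c →
      ∃ d, refl i *ᵥ latticeVec c = latticeVec d ∧ latticeNorm d = latticeNorm c :=
    fun d h h' => ⟨d, funext h, h'⟩
  fin_cases i
  · refine key ![c 0, -c 1, c 2, c 3, c 4] ?_ (by simp [latticeNorm])
    intro k
    fin_cases k <;> simp [refl, mulVec, dotProduct, Fin.sum_univ_five, latticeVec]
  · refine key ![c 0, c 2, c 1, c 3, c 4] ?_ (by simp [latticeNorm]; ring)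
    intro k
    fin_cases k <;> simp [refl, mulVec, dotProduct, Fin.sum_univ_five, latticeVec]
  · refine key ![c 0, c 1, c 3, c 2, c 4] ?_ (by simp [latticeNorm]; ring)
    intro k
    fin_cases k <;> simp [refl, mulVec, dotProduct, Fin.sum_univ_five, latticeVec]
  · refine key ![c 0, c 1, c 2, c 4, c 3] ?_ (by simp [latticeNorm]; ring)
    intro k
    fin_cases k <;> simp [refl, mulVec, dotProduct, Fin.sum_univ_five, latticeVec]
  · refine key ![gold * c 0 - c 4, c 1, c 2, c 3, gold * c 0 - gold * c 4] ?_ ?_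
    · intro k
      simp only [refl, mulVec, dotProduct, Fin.sum_univ_five, latticeVec]
      generalize √goldenRatio = s at h2 ⊢
      fin_cases k <;> simp [toReal_gold]
      · ring
      · linear_combination toReal (c 0) * h2
    · simp [latticeNorm]
      linear_combination (-gold * c 0 ^ 2 + c 4 ^ 2) * gold_mul_self

theorem exists_latticeVec_of_mem_roots {r : Fin 5 → ℝ} (hr : r ∈ roots) :
    ∃ c, r = latticeVec c ∧ latticeNorm c = 1 := by
  obtain ⟨g, hg, rfl⟩ := hr
  refine Gam_induction (P := fun g => ∃ c, g.1 *ᵥ baseRoot = latticeVec c ∧ latticeNorm c = 1)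
    ⟨![0, 1, 0, 0, 0], ?_, by simp [latticeNorm]⟩ ?_ hg
  · ext k
    fin_cases k <;> simp [baseRoot, latticeVec]
  · rintro i g ⟨c, hc, hc1⟩
    obtain ⟨d, hd, hdc⟩ := refl_mulVec_latticeVec i c
    refine ⟨d, ?_, hdc.trans hc1⟩
    rw [Units.val_mul, ← mulVec_mulVec, hc]
    exact hd

theorem toRealConj_latticeNorm {c : Fin 5 → GoldenInt} (hc : latticeNorm c = 1) :
    -goldenConj * toRealConj (c 0) ^ 2 + toRealConj (c 1) ^ 2 + toRealConj (c 2) ^ 2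
      + toRealConj (c 3) ^ 2 + toRealConj (c 4) ^ 2 = 1 := by
  have h := congrArg toRealConj hc
  simpa [latticeNorm, toRealConj_gold] using h

/-- The hyperplane of a root other than `baseRoot` up to sign is orthogonal to that of `baseRoot`
or disjoint from it, as the conjugate of the product of the two roots is less than one. -/
theorem root_coord_one {r : Fin 5 → ℝ} (hr : r ∈ roots) :
    r = baseRoot ∨ r = -baseRoot ∨ r 1 = 0 ∨ 1 < |r 1| := by
  obtain ⟨c, rfl, hc⟩ := exists_latticeVec_of_mem_roots hr
  have hN := toRealConj_latticeNorm hc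
  have hpos : 0 < -goldenConj := neg_pos.2 goldenConj_neg
  have h1 : (latticeVec c) 1 = toReal (c 1) := by simp [latticeVec]
  have p0 : 0 ≤ -goldenConj * toRealConj (c 0) ^ 2 := by positivity
  have p2 := sq_nonneg (toRealConj (c 2))
  have p3 := sq_nonneg (toRealConj (c 3))
  have p4 := sq_nonneg (toRealConj (c 4))
  rcases eq_or_ne (c 1) 0 with h0 | h0
  · exact Or.inr (Or.inr (Or.inl (by rw [h1, h0, map_zero])))
  have hab := one_le_abs_toReal_mul_abs_toRealConj h0
  have hle : toRealConj (c 1) ^ 2 ≤ 1 := by linarith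
  rcases hle.lt_or_eq with hlt | heq
  · refine Or.inr (Or.inr (Or.inr ?_))
    rw [h1]
    have hlt' : |toRealConj (c 1)| < 1 := (sq_lt_one_iff_abs_lt_one _).1 hlt
    by_contra! hcon
    nlinarith [abs_nonneg (toReal (c 1)), abs_nonneg (toRealConj (c 1))]
  · have z0 : c 0 = 0 := toRealConj_injective (by
      have : -goldenConj * toRealConj (c 0) ^ 2 = 0 := by linarith
      rw [map_zero]
      exact pow_eq_zero_iff two_ne_zero |>.1 ((mul_eq_zero.1 this).resolve_left hpos.ne'))
    have z2 : c 2 = 0 := toRealConj_injective (by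
      rw [map_zero]; exact pow_eq_zero_iff two_ne_zero |>.1 (by linarith))
    have z3 : c 3 = 0 := toRealConj_injective (by
      rw [map_zero]; exact pow_eq_zero_iff two_ne_zero |>.1 (by linarith))
    have z4 : c 4 = 0 := toRealConj_injective (by
      rw [map_zero]; exact pow_eq_zero_iff two_ne_zero |>.1 (by linarith))
    rcases sq_eq_one_iff.1 heq with h | h
    · have z1 : c 1 = 1 := toRealConj_injective (by rw [h, map_one])
      left
      ext k
      fin_cases k <;> simp [latticeVec, baseRoot, z0, z1, z2, z3, z4]
    · have z1 : c 1 = -1 := toRealConj_injective (by rw [h, map_neg, map_one])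
      right; left
      ext k
      fin_cases k <;> simp [latticeVec, baseRoot, z0, z1, z2, z3, z4]

theorem root_trichotomy {r s : Fin 5 → ℝ} (hr : r ∈ roots) (hs : s ∈ roots) :
    s = r ∨ s = -r ∨ lor s r = 0 ∨ 1 < |lor s r| := by
  obtain ⟨g, hg, rfl⟩ := hr
  have h := root_coord_one (inv_mulVec_mem_roots hg hs)
  have hl : lor s (g.1 *ᵥ baseRoot) = (g⁻¹.1 *ᵥ s) 1 := by
    rw [lor_comm, lor_mulVec_left hg]
    simp [lor, baseRoot]
  have hgs := mulVec_inv_mulVec g s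
  rw [hl]
  rcases h with h | h | h | h
  · left; rw [← hgs, h]
  · right; left; rw [← hgs, h, mulVec_neg]
  · exact Or.inr (Or.inr (Or.inl h))
  · exact Or.inr (Or.inr (Or.inr h))

/-- The pairing of a root with the base vertex is odd. -/
theorem exists_eq_one_add_two_mul {c : Fin 5 → GoldenInt} (hc : latticeNorm c = 1) :
    ∃ s, -gold ^ 2 * c 0 + c 1 + c 2 + c 3 + c 4 = 1 + (s + s) := by
  set z := -gold ^ 2 * c 0 + c 1 + c 2 + c 3 + c 4 with hz
  obtain ⟨y, hy⟩ : ∃ y, z * z = 1 + (y + y) := by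
    refine ⟨(2 * gold + 1) * c 0 ^ 2 - gold ^ 2 * c 0 * (c 1 + c 2 + c 3 + c 4)
      + c 1 * (c 2 + c 3 + c 4) + c 2 * (c 3 + c 4) + c 3 * c 4, ?_⟩
    rw [latticeNorm] at hc
    rw [hz]
    linear_combination hc + c 0 ^ 2 * (gold ^ 2 + gold + 2) * gold_mul_self
  have hre := congrArg QuadraticAlgebra.re hy
  have him := congrArg QuadraticAlgebra.im hy
  have re_one : (1 : GoldenInt).re = 1 := rfl
  have im_one : (1 : GoldenInt).im = 0 := rfl
  simp [re_one, im_one] at hre him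
  have hq : Even z.im := by
    by_contra h
    rw [Int.not_even_iff_odd] at h
    obtain ⟨k, hk⟩ := h
    have : Odd (z.re * z.im + z.im * z.re + z.im * z.im) :=
      ⟨z.re * z.im + 2 * k ^ 2 + 2 * k, by rw [hk]; ring⟩
    rw [him] at this
    exact (Int.not_even_iff_odd.2 this) ⟨_, rfl⟩
  have hp : Odd z.re := by
    by_contra h
    rw [Int.not_odd_iff_even] at h
    have : Even (z.re * z.re + z.im * z.im) := (h.mul_left _).add (hq.mul_left _)
    rw [hre] at this
    exact (Int.not_even_iff_odd.2 ⟨y.re, by ring⟩) this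
  obtain ⟨p, hp⟩ := hp
  obtain ⟨q, hq⟩ := hq
  refine ⟨⟨p, q⟩, QuadraticAlgebra.ext ?_ ?_⟩
  · simp [hp, re_one]; ring
  · simp [hq, im_one]

theorem one_le_abs_lor_baseVertex {r : Fin 5 → ℝ} (hr : r ∈ roots) : 1 ≤ |lor baseVertex r| := by
  obtain ⟨c, rfl, hc⟩ := exists_latticeVec_of_mem_roots hr
  obtain ⟨s, hs⟩ := exists_eq_one_add_two_mul hc
  have hl : lor baseVertex (latticeVec c) = 1 + 2 * toReal s := by
    have h := congrArg toReal hs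
    have h2 := sqrt_goldenRatio_mul_self
    simp only [lor, baseVertex, latticeVec]
    generalize √goldenRatio = t at h2 ⊢
    simp [toReal_gold] at h ⊢
    linear_combination h - goldenRatio * toReal (c 0) * h2 - toReal (c 0) * goldenRatio_sq
  have hconj : |1 + 2 * toRealConj s| < 3 := by
    have h := congrArg toRealConj hs
    simp [toRealConj_gold] at h
    have hN := toRealConj_latticeNorm hc
    have hneg := goldenConj_neg
    have hgt := neg_one_lt_goldenConj
    rw [two_mul, ← h, ← goldenConj_sq]
    generalize toRealConj (c 0) = c0 at *
    generalize toRealConj (c 1) = c1 at *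
    generalize toRealConj (c 2) = c2 at *
    generalize toRealConj (c 3) = c3 at *
    generalize toRealConj (c 4) = c4 at *
    generalize goldenConj = f at *
    have hsum : |c1 + c2 + c3 + c4| ≤ 2 := by
      refine abs_le_of_sq_le_sq ?_ zero_le_two
      have : 0 ≤ -f * c0 ^ 2 := mul_nonneg (by linarith) (sq_nonneg _)
      nlinarith [sq_nonneg (c1 - c2), sq_nonneg (c1 - c3), sq_nonneg (c1 - c4),
        sq_nonneg (c2 - c3), sq_nonneg (c2 - c4), sq_nonneg (c3 - c4)]
    have hfirst : |f ^ 2 * c0| < 1 := by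
      refine abs_lt_of_sq_lt_sq ?_ zero_le_one
      have h1 : -f * c0 ^ 2 ≤ 1 := by
        nlinarith [sq_nonneg c1, sq_nonneg c2, sq_nonneg c3, sq_nonneg c4]
      have h3 : (-f) ^ 3 < 1 := pow_lt_one₀ (by linarith) (by linarith) (by norm_num)
      have h4 : 0 < (-f) ^ 3 := pow_pos (by linarith) 3
      calc (f ^ 2 * c0) ^ 2 = (-f) ^ 3 * (-f * c0 ^ 2) := by ring
        _ ≤ (-f) ^ 3 * 1 := by gcongr
        _ < 1 ^ 2 := by linarith
    rw [abs_lt] at hfirst ⊢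
    rw [abs_le] at hsum
    constructor <;> linarith [hfirst.1, hfirst.2, hsum.1, hsum.2]
  rw [hl]
  by_contra! hcon
  rw [abs_lt] at hcon hconj
  -- The real numbers `s` and `s + 1` have absolute value less than one, so by the integrality of
  -- norms both of their conjugates exceed one in absolute value, which contradicts `hconj`.
  have hs0 : s ≠ 0 := by
    rintro rfl
    simp at hcon
  have hs1 : s + 1 ≠ 0 := by
    intro h
    rw [eq_neg_of_add_eq_zero_left h] at hcon
    norm_num at hcon
  have n0 := one_le_abs_toReal_mul_abs_toRealConj hs0
  have n1 := one_le_abs_toReal_mul_abs_toRealConj hs1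
  rw [map_add, map_add, map_one, map_one] at n1
  generalize toReal s = a at *
  generalize toRealConj s = b at *
  rw [abs_of_neg (by linarith : a < 0)] at n0
  rw [abs_of_pos (by linarith : 0 < a + 1)] at n1
  rcases abs_cases b with ⟨hb, -⟩ | ⟨hb, -⟩ <;>
    rcases abs_cases (b + 1) with ⟨hb', -⟩ | ⟨hb', -⟩ <;>
    rw [hb] at n0 <;> rw [hb'] at n1 <;> nlinarith

theorem one_le_abs_lor {x r : Fin 5 → ℝ} (hx : x ∈ vertexPoints) (hr : r ∈ roots) :
    1 ≤ |lor x r| := by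
  obtain ⟨g, hg, rfl⟩ := hx
  rw [lor_mulVec_left hg]
  exact one_le_abs_lor_baseVertex (inv_mulVec_mem_roots hg hr)

theorem lor_ne_zero {x r : Fin 5 → ℝ} (hx : x ∈ vertexPoints) (hr : r ∈ roots) :
    lor x r ≠ 0 := by
  intro h
  have := one_le_abs_lor hx hr
  rw [h] at this
  norm_num at this

theorem one_le_lor {x r : Fin 5 → ℝ} (hx : x ∈ vertexPoints) (hr : r ∈ roots) (h : -1 < lor x r) :
    1 ≤ lor x r := by
  rcases le_abs.1 (one_le_abs_lor hx hr) with h' | h' <;> linarith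

theorem lor_le_neg_one {x r : Fin 5 → ℝ} (hx : x ∈ vertexPoints) (hr : r ∈ roots)
    (h : lor x r < 1) : lor x r ≤ -1 := by
  rcases le_abs.1 (one_le_abs_lor hx hr) with h' | h' <;> linarith

/-! ### Paths and the hyperplanes they cross -/

theorem lor_lt_neg_one_or {r s : Fin 5 → ℝ} (hr : r ∈ roots) (hs : s ∈ roots)
    (h1 : s ≠ r) (h2 : s ≠ -r) : lor s r < -1 ∨ lor s r = 0 ∨ 1 < lor s r := by
  rcases root_trichotomy hr hs with h | h | h | h
  · exact absurd h h1
  · exact absurd h h2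
  · exact Or.inr (Or.inl h)
  · rcases lt_abs.1 h with h | h
    · exact Or.inr (Or.inr h)
    · exact Or.inl (by linarith)

theorem lor_sub_self_lt_zero {r s : Fin 5 → ℝ} (hr : r ∈ roots) (hs : s ∈ roots)
    (h : 1 < lor s r) : lor (s - r) (s - r) < 0 := by
  rw [lor_sub_left, lor_sub_right, lor_sub_right, lor_self_of_mem_roots hr,
    lor_self_of_mem_roots hs, lor_comm r s]
  linarith

theorem lor_add_self_lt_zero {r s : Fin 5 → ℝ} (hr : r ∈ roots) (hs : s ∈ roots)
    (h : lor s r < -1) : lor (s + r) (s + r) < 0 := by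
  rw [lor_add_left, lor_add_right, lor_add_right, lor_self_of_mem_roots hr,
    lor_self_of_mem_roots hs, lor_comm r s]
  linarith

/-- At most four hyperplanes are pairwise orthogonal. -/
theorem card_le_four_of_orthogonal {n : ℕ → Fin 5 → ℝ} (s : Finset ℕ) (hs : ∀ i ∈ s, n i ∈ roots)
    (h : ∀ i ∈ s, ∀ j ∈ s, i < j → lor (n j) (n i) = 0) : s.card ≤ 4 := by
  by_contra! hcard
  obtain ⟨t, hts, ht⟩ := Finset.exists_subset_card_eq (show 5 ≤ s.card from hcard)
  let e := t.orderEmbOfFin ht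
  have he : ∀ i, e i ∈ s := fun i => hts (t.orderEmbOfFin_mem ht i)
  refine not_orthonormal_five (fun i => n (e i)) fun i j => ?_
  rcases lt_trichotomy i j with hij | rfl | hij
  · rw [if_neg hij.ne, lor_comm]
    exact h _ (he i) _ (he j) (e.lt_iff_lt.2 hij)
  · rw [if_pos rfl]
    exact lor_self_of_mem_roots (hs _ (he i))
  · rw [if_neg hij.ne']
    exact h _ (he j) _ (he i) (e.lt_iff_lt.2 hij)

/-- The vertices `x 0, …, x ℓ` of a path of edges, where the `i`-th edge leads from `x i` to
`x (i + 1)` and crosses the hyperplane with normal `n i`, oriented along the path, such that any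
eight consecutive edges cross different hyperplanes. -/
structure IsLocalPath (x n : ℕ → Fin 5 → ℝ) (ℓ : ℕ) : Prop where
  vertex : ∀ i, x i ∈ vertexPoints
  root : ∀ i < ℓ, n i ∈ roots
  step : ∀ i < ℓ, x (i + 1) = x i + (2 : ℝ) • n i
  lor_self : ∀ i < ℓ, lor (x i) (n i) = -1
  local_ne : ∀ i j, i < j → j < i + 8 → j < ℓ → n j ≠ n i ∧ n j ≠ -n i

namespace IsLocalPath

variable {x n : ℕ → Fin 5 → ℝ} {ℓ : ℕ} (P : IsLocalPath x n ℓ)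
include P

theorem lor_succ {i : ℕ} (hi : i < ℓ) (r : Fin 5 → ℝ) :
    lor (x (i + 1)) r = lor (x i) r + 2 * lor (n i) r := by
  rw [P.step i hi, lor_add_left, lor_smul_left]

theorem lor_succ_self {i : ℕ} (hi : i < ℓ) : lor (x (i + 1)) (n i) = 1 := by
  rw [P.lor_succ hi, P.lor_self i hi, lor_self_of_mem_roots (P.root i hi)]
  norm_num

theorem lor_mul_lor_pos {u : Fin 5 → ℝ} (hu : lor u u < 0) (i j : ℕ) :
    0 < lor (x i) u * lor (x j) u :=
  (isFuture_of_mem_vertexPoints (P.vertex i)).lor_mul_lor_pos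
    (isFuture_of_mem_vertexPoints (P.vertex j)) hu

/-- An edge crosses no hyperplane other than its bisector. -/
theorem lor_mul_lor_succ_pos {i : ℕ} (hi : i < ℓ) {r : Fin 5 → ℝ} (hr : r ∈ roots)
    (h1 : n i ≠ r) (h2 : n i ≠ -r) : 0 < lor (x i) r * lor (x (i + 1)) r := by
  have hn := P.root i hi
  have hs := P.lor_succ hi r
  rcases lor_lt_neg_one_or hr hn h1 h2 with h | h | h
  · have ht := P.lor_mul_lor_pos (lor_add_self_lt_zero hr hn h) i (i + 1)
    rw [lor_add_right, lor_add_right, P.lor_self i hi, P.lor_succ_self hi] at ht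
    rcases lt_or_gt_of_ne (lor_ne_zero (P.vertex i) hr) with h3 | h3
    · nlinarith
    · have h4 := one_le_lor (P.vertex i) hr (by linarith)
      nlinarith [one_le_lor (P.vertex (i + 1)) hr (by nlinarith)]
  · rw [hs, h, mul_zero, add_zero]
    exact mul_self_pos.2 (lor_ne_zero (P.vertex i) hr)
  · have ht := P.lor_mul_lor_pos (lor_sub_self_lt_zero hr hn h) i (i + 1)
    rw [lor_sub_right, lor_sub_right, P.lor_self i hi, P.lor_succ_self hi] at ht
    rcases lt_or_gt_of_ne (lor_ne_zero (P.vertex i) hr) with h3 | h3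
    · have h4 := lor_le_neg_one (P.vertex i) hr (by linarith)
      nlinarith [lor_le_neg_one (P.vertex (i + 1)) hr (by nlinarith)]
    · nlinarith

/-- A path segment none of whose edges crosses the hyperplane of `r` stays on one side of it. -/
theorem lor_mul_lor_pos_of_not_crossing {r : Fin 5 → ℝ} (hr : r ∈ roots) {a b : ℕ} (hab : a ≤ b)
    (hb : b ≤ ℓ) (h : ∀ c, a ≤ c → c < b → n c ≠ r ∧ n c ≠ -r) :
    0 < lor (x a) r * lor (x b) r := by
  induction b, hab using Nat.le_induction with
  | base => exact mul_self_pos.2 (lor_ne_zero (P.vertex a) hr)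
  | succ b hab ih =>
    have h1 := ih (by omega) fun c h1 h2 => h c h1 (by omega)
    have h2 := P.lor_mul_lor_succ_pos (by omega : b < ℓ) hr (h b hab (by omega)).1
      (h b hab (by omega)).2
    have h3 : 0 < (lor (x a) r * lor (x (b + 1)) r) * (lor (x b) r) ^ 2 := by
      have := mul_pos h1 h2
      nlinarith
    exact pos_of_mul_pos_left h3 (sq_nonneg _)

/-- A hyperplane which separates two vertices of a path is crossed between them. -/
theorem exists_crossing {r : Fin 5 → ℝ} (hr : r ∈ roots) {a b : ℕ} (hab : a ≤ b) (hb : b ≤ ℓ)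
    (h : lor (x a) r * lor (x b) r < 0) : ∃ c, a ≤ c ∧ c < b ∧ (n c = r ∨ n c = -r) := by
  by_contra! hcon
  exact absurd (P.lor_mul_lor_pos_of_not_crossing hr hab hb hcon) h.not_gt

/-- If the path crosses a hyperplane and gets back to the other side, then there is a first edge
which crosses it again, and this is at least eight edges later. -/
theorem exists_next_crossing {k b : ℕ} (hk : k < b) (hb : b ≤ ℓ) (h : lor (x b) (n k) < 0) :
    ∃ j, k + 8 ≤ j ∧ j < b ∧ (n j = n k ∨ n j = -n k) ∧
      ∀ c, k < c → c < j → n c ≠ n k ∧ n c ≠ -n k := by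
  have hkℓ : k < ℓ := by omega
  have hex : ∃ c, k + 1 ≤ c ∧ c < b ∧ (n c = n k ∨ n c = -n k) :=
    P.exists_crossing (P.root k hkℓ) hk hb (by rw [P.lor_succ_self hkℓ]; linarith)
  classical
  obtain ⟨h1, h2, h3⟩ := Nat.find_spec hex
  refine ⟨Nat.find hex, ?_, h2, h3, fun c hc1 hc2 => ?_⟩
  · by_contra! hlt
    have := P.local_ne k _ (by omega) hlt (by omega)
    tauto
  · have := Nat.find_min hex hc2
    have hcb : c < b := by omega
    tauto

/-- Between two consecutive crossings of a hyperplane, the path crosses only hyperplanes orthogonal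
to it, so it stays in the layer of hypercubes cut by this hyperplane.

Otherwise the path leaves the layer, across a hyperplane `p` disjoint from the hyperplane `h`. It
has to cross `p` again, after at least seven edges which are orthogonal to `p` by induction on the
length. None of these seven edges leads towards `h`, as it would cross a hyperplane crossed before
leaving the layer. Those orthogonal to `h` are also orthogonal to each other, being orthogonal to
the timelike vector `p - h`, so together with `h` they are at most four. Those which lead away from
`h` have to be crossed again like `p`, so they are orthogonal to each other as well, and together
with `p` they are at most four. This makes at most six edges. -/
theorem orthogonal_of_consecutive_crossings (d : ℕ) : ∀ i j, j = i + d → i < j → j < ℓ →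
    (n j = n i ∨ n j = -n i) → (∀ c, i < c → c < j → n c ≠ n i ∧ n c ≠ -n i) →
    ∀ k, i < k → k < j → lor (n k) (n i) = 0 := by
  induction d using Nat.strong_induction_on with
  | _ d IH =>
  intro i j hd hij hj hcross hno k₀ hk₀ hk₀j
  have hiℓ : i < ℓ := by omega
  have hh := P.root i hiℓ
  set h := n i with hhdef
  have hpos : ∀ t, i < t → t ≤ j → 1 ≤ lor (x t) h := by
    intro t h1 h2
    have := P.lor_mul_lor_pos_of_not_crossing hh (a := i + 1) (b := t) h1 (by omega)
      fun c hc1 hc2 => hno c hc1 (by omega)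
    rw [hhdef, P.lor_succ_self hiℓ, one_mul] at this
    exact one_le_lor (P.vertex t) hh (by linarith)
  have hnj : n j = -h := by
    refine hcross.resolve_left fun hj' => ?_
    have h1 := P.lor_self j hj
    have h2 := hpos j hij le_rfl
    rw [hj'] at h1
    linarith
  have hxj : lor (x j) h = 1 := by
    have h1 := P.lor_self j hj
    rw [hnj, lor_neg_right] at h1
    linarith
  by_contra hne
  -- The first edge between the crossings which is not orthogonal to `h`.
  classical
  have hex : ∃ k, i < k ∧ k < j ∧ lor (n k) h ≠ 0 := ⟨k₀, hk₀, hk₀j, hne⟩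
  obtain ⟨hik, hkj, hk⟩ := Nat.find_spec hex
  have hmin : ∀ m, i < m → m < Nat.find hex → lor (n m) h = 0 := by
    intro m h1 h2
    by_contra h3
    exact Nat.find_min hex h2 ⟨h1, by omega, h3⟩
  set k := Nat.find hex
  have hkℓ : k < ℓ := by omega
  have hxk : ∀ t, i + 1 ≤ t → t ≤ k → lor (x t) h = 1 := by
    intro t ht
    induction t, ht using Nat.le_induction with
    | base => exact fun _ => P.lor_succ_self hiℓ
    | succ t ht ih =>
      intro htk
      rw [P.lor_succ (by omega), ih (by omega), hmin t (by omega) (by omega)]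
      norm_num
  have hkp : 1 < lor (n k) h := by
    have h1 := hpos (k + 1) (by omega) (by omega)
    rw [P.lor_succ hkℓ, hxk k hik le_rfl] at h1
    rcases lor_lt_neg_one_or hh (P.root k hkℓ) (hno k hik hkj).1 (hno k hik hkj).2 with h2 | h2 | h2
    · linarith
    · exact absurd h2 hk
    · exact h2
  -- A hyperplane crossed by an edge leading away from `h` separates the end of this edge from `h`,
  -- so it is crossed again before `j`, and the induction hypothesis applies.
  have hup : ∀ m, i < m → m < j → 1 < lor (n m) h →
      m + 8 ≤ j ∧ ∀ c, m < c → c < m + 8 → lor (n c) (n m) = 0 := by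
    intro m him hmj hm
    have hmℓ : m < ℓ := by omega
    have hneg := P.lor_mul_lor_pos (lor_sub_self_lt_zero hh (P.root m hmℓ) hm) m j
    rw [lor_sub_right, lor_sub_right, hxj, P.lor_self m hmℓ] at hneg
    have h1 := hpos m him hmj.le
    have h2 := lor_le_neg_one (P.vertex j) (P.root m hmℓ) (by nlinarith)
    obtain ⟨j', h4, h5, h6, h7⟩ := P.exists_next_crossing hmj hj.le (by linarith)
    refine ⟨by omega, fun c hc1 hc2 => ?_⟩
    exact IH (j' - m) (by omega) m j' (by omega) (by omega) (by omega) h6 h7 c hc1 (by omega)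
  obtain ⟨hk8, hpk⟩ := hup k hik hkj hkp
  have hfar : ∀ m, k + 1 ≤ m → m ≤ k + 8 → 1 < lor (x m) h ∧
      ∀ c, k < c → c < m → lor (n c) h = 0 ∨ 1 < lor (n c) h := by
    intro m hm
    induction m, hm using Nat.le_induction with
    | base =>
      intro _
      refine ⟨?_, fun c h1 h2 => by omega⟩
      rw [P.lor_succ hkℓ, hxk k hik le_rfl]
      linarith
    | succ m hm ih =>
      intro hm8
      obtain ⟨ih1, ih2⟩ := ih (by omega)
      have hmℓ : m < ℓ := by omega
      have hstep : lor (n m) h = 0 ∨ 1 < lor (n m) h := by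
        have hm' := hno m (by omega) (by omega)
        refine (lor_lt_neg_one_or hh (P.root m hmℓ) hm'.1 hm'.2).resolve_left fun hdown => ?_
        -- The hyperplane of `n m` separates `x m` from `h`, so it has been crossed after `i`,
        -- hence before `k`. But all hyperplanes crossed between `i` and `k` are orthogonal to `h`.
        have hneg := P.lor_mul_lor_pos (lor_add_self_lt_zero hh (P.root m hmℓ) hdown) m i
        rw [lor_add_right, lor_add_right, P.lor_self m hmℓ, P.lor_self i hiℓ] at hneg
        have h1 : 0 < lor (x i) (n m) := by nlinarith
        have h2 : 0 < lor (x (i + 1)) (n m) := by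
          have := P.lor_mul_lor_succ_pos hiℓ (P.root m hmℓ) hm'.1.symm
            (fun he => hm'.2 (by rw [hhdef, he, neg_neg]))
          exact (pos_iff_pos_of_mul_pos this).1 h1
        obtain ⟨c, hc1, hc2, hc3⟩ := P.exists_crossing (P.root m hmℓ) (a := i + 1) (b := m)
          (by omega) hmℓ.le (by rw [P.lor_self m hmℓ]; linarith)
        have hck : c < k := by
          by_contra! hck
          have := P.local_ne c m hc2 (by omega) hmℓ
          rcases hc3 with hc3 | hc3
          · exact this.1 hc3.symm
          · exact this.2 (by rw [hc3, neg_neg])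
        have := hmin c (by omega) hck
        rcases hc3 with hc3 | hc3 <;> rw [hc3] at this
        · linarith
        · rw [lor_neg_left] at this
          linarith
      refine ⟨?_, fun c h1 h2 => ?_⟩
      · rw [P.lor_succ hmℓ]
        rcases hstep with h1 | h1 <;> linarith
      · rcases Nat.lt_succ_iff_lt_or_eq.1 h2 with h2 | rfl
        · exact ih2 c h1 h2
        · exact hstep
  have hkind := (hfar (k + 8) (by omega) le_rfl).2
  let W := Finset.Ioo k (k + 8)
  let F := W.filter fun m => lor (n m) h = 0
  let U := W.filter fun m => 1 < lor (n m) h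
  have hF : (insert i F).card ≤ 4 := by
    refine card_le_four_of_orthogonal _ (fun a ha => P.root a ?_) fun a ha b hb hab => ?_
    · simp only [F, W, Finset.mem_insert, Finset.mem_filter, Finset.mem_Ioo] at ha
      omega
    · simp only [F, W, Finset.mem_insert, Finset.mem_filter, Finset.mem_Ioo] at ha hb
      obtain ⟨hb1, hb2⟩ := hb.resolve_left (by omega)
      rcases ha with rfl | ⟨ha1, ha2⟩
      · exact hb2
      · have hne := P.local_ne a b hab (by omega) (by omega)
        have hu := lor_sub_self_lt_zero hh (P.root k hkℓ) hkp
        rcases lor_lt_neg_one_or (P.root a (by omega)) (P.root b (by omega)) hne.1 hne.2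
          with h1 | h1 | h1
        · have hv := lor_add_self_lt_zero (P.root a (by omega)) (P.root b (by omega)) h1
          refine absurd ?_ (lor_ne_zero_of_timelike hv hu)
          rw [lor_add_left, lor_sub_right, lor_sub_right, ha2, hb2, hpk a ha1.1 ha1.2,
            hpk b hb1.1 hb1.2]
          norm_num
        · exact h1
        · have hv := lor_sub_self_lt_zero (P.root a (by omega)) (P.root b (by omega)) h1
          refine absurd ?_ (lor_ne_zero_of_timelike hv hu)
          rw [lor_sub_left, lor_sub_right, lor_sub_right, ha2, hb2, hpk a ha1.1 ha1.2,
            hpk b hb1.1 hb1.2]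
          norm_num
  have hU : (insert k U).card ≤ 4 := by
    refine card_le_four_of_orthogonal _ (fun a ha => P.root a ?_) fun a ha b hb hab => ?_
    · simp only [U, W, Finset.mem_insert, Finset.mem_filter, Finset.mem_Ioo] at ha
      omega
    · simp only [U, W, Finset.mem_insert, Finset.mem_filter, Finset.mem_Ioo] at ha hb
      obtain ⟨hb1, hb2⟩ := hb.resolve_left (by omega)
      rcases ha with rfl | ⟨ha1, ha2⟩
      · exact hpk b hb1.1 hb1.2
      · exact (hup a (by omega) (by omega) ha2).2 b hab (by omega)
  rw [Finset.card_insert_of_notMem (by simp [F, W]; omega)] at hF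
  rw [Finset.card_insert_of_notMem (by simp [U, W])] at hU
  have hW : W ⊆ F ∪ U := by
    intro m hm
    have hm' := Finset.mem_Ioo.1 hm
    rcases hkind m hm'.1 hm'.2 with h1 | h1
    · exact Finset.mem_union_left _ (Finset.mem_filter.2 ⟨hm, h1⟩)
    · exact Finset.mem_union_right _ (Finset.mem_filter.2 ⟨hm, h1⟩)
  have h1 := (Finset.card_le_card hW).trans (Finset.card_union_le F U)
  rw [Nat.card_Ioo] at h1
  omega

/-- The first five hyperplanes crossed by a closed path would all be crossed again, and so they
would be pairwise orthogonal. -/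
theorem not_closed (hℓ : 8 < ℓ) : x ℓ ≠ x 0 := by
  intro hclosed
  have hc : (Finset.range 5).card ≤ 4 := by
    refine card_le_four_of_orthogonal _ (fun a ha => P.root a ?_) fun a ha b hb hab => ?_
    · have := Finset.mem_range.1 ha
      omega
    · rw [Finset.mem_range] at ha hb
      have haℓ : a < ℓ := by omega
      have hneg : lor (x ℓ) (n a) < 0 := by
        have := P.lor_mul_lor_pos_of_not_crossing (P.root a haℓ) (Nat.zero_le a) haℓ.le
          fun c _ hca => by
            have := P.local_ne c a hca (by omega) haℓ
            exact ⟨this.1.symm, fun h => this.2 (by rw [h, neg_neg])⟩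
        rw [P.lor_self a haℓ] at this
        rw [hclosed]
        linarith
      obtain ⟨j, h1, h2, h3, h4⟩ := P.exists_next_crossing haℓ le_rfl hneg
      exact P.orthogonal_of_consecutive_crossings (j - a) a j (by omega) (by omega) h2 h3 h4 b hab
        (by omega)
  simp at hc

end IsLocalPath

/-! ### The graph of vertices and edges -/

theorem gen_mulVec_baseVertex {j : Fin 5} (hj : j ≠ 0) : (gen j).1 *ᵥ baseVertex = baseVertex := by
  change refl j *ᵥ baseVertex = baseVertex
  have h1 := Real.goldenRatio_sq
  have h2 := sqrt_goldenRatio_mul_self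
  ext k
  simp only [refl, baseVertex, mulVec, dotProduct, Fin.sum_univ_five]
  generalize √Real.goldenRatio = s at h2 ⊢
  generalize Real.goldenRatio = f at h1 h2 ⊢
  fin_cases j
  · exact absurd rfl hj
  all_goals fin_cases k <;> simp
  · linear_combination s * h1
  · linear_combination f * h2 + h1

theorem mulVec_baseVertex_of_mem_faceStab {s : Gam} (hs : s ∈ faceStab 0) :
    s.1.1 *ᵥ baseVertex = baseVertex := by
  rw [faceStab, Subgroup.mem_subgroupOf] at hs
  refine Subgroup.closure_induction_left (p := fun g _ => g.1 *ᵥ baseVertex = baseVertex)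
    (by simp) ?_ ?_ hs
  · rintro _ ⟨j, hj, rfl⟩ y _ hy
    rw [Units.val_mul, ← mulVec_mulVec, hy, gen_mulVec_baseVertex hj]
  · rintro _ ⟨j, hj, rfl⟩ y _ hy
    rw [gen_inv, Units.val_mul, ← mulVec_mulVec, hy, gen_mulVec_baseVertex hj]

/-- The point of the hyperboloid (up to scale) which represents a vertex of the tessellation. -/
noncomputable def point (v : Face 0) : Fin 5 → ℝ :=
  Quotient.liftOn' v (fun g : Gam => g.1.1 *ᵥ baseVertex) (by
    intro g k hgk
    rw [QuotientGroup.leftRel_apply] at hgk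
    have := mulVec_baseVertex_of_mem_faceStab hgk
    change g.1.1 *ᵥ baseVertex = k.1.1 *ᵥ baseVertex
    conv_lhs => rw [← this]
    rw [mulVec_mulVec, ← Units.val_mul, ← Subgroup.coe_mul, mul_inv_cancel_left])

theorem point_mk (g : Gam) : point (QuotientGroup.mk g) = g.1.1 *ᵥ baseVertex := rfl

theorem point_mem_vertexPoints (v : Face 0) : point v ∈ vertexPoints := by
  induction v using QuotientGroup.induction_on with
  | H g => exact ⟨g.1, g.2, rfl⟩

theorem gen_zero_mul_gen {j : Fin 5} (hj : j ≠ 1) : gen 0 * gen j = gen j * gen 0 := by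
  refine Units.ext ?_
  change refl 0 * refl j = refl j * refl 0
  fin_cases j
  · rfl
  · exact absurd rfl hj
  all_goals
    ext a b
    fin_cases a <;> fin_cases b <;> simp [refl, Matrix.mul_apply, Fin.sum_univ_five]

theorem mem_closure_or_gen_zero_mul_mem_closure {s : GL (Fin 5) ℝ}
    (hs : s ∈ Subgroup.closure (gen '' {j | j ≠ 1})) :
    s ∈ Subgroup.closure (gen '' {j | j ≠ 0}) ∨
      gen 0 * s ∈ Subgroup.closure (gen '' {j | j ≠ 0}) := by
  have key : ∀ j ∈ {j : Fin 5 | j ≠ 1}, ∀ y,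
      (y ∈ Subgroup.closure (gen '' {j | j ≠ 0}) ∨
        gen 0 * y ∈ Subgroup.closure (gen '' {j | j ≠ 0})) →
      (gen j * y ∈ Subgroup.closure (gen '' {j | j ≠ 0}) ∨
        gen 0 * (gen j * y) ∈ Subgroup.closure (gen '' {j | j ≠ 0})) := by
    intro j hj y hy
    by_cases h0 : j = 0
    · subst h0
      rw [← mul_assoc, show gen 0 * gen 0 = 1 from mul_inv_cancel (gen 0), one_mul]
      exact hy.symm
    · have hmem : gen j ∈ Subgroup.closure (gen '' {j | j ≠ 0}) :=
        Subgroup.subset_closure ⟨j, h0, rfl⟩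
      rw [← mul_assoc (gen 0), gen_zero_mul_gen hj, mul_assoc]
      exact hy.imp (mul_mem hmem) (mul_mem hmem)
  refine Subgroup.closure_induction_left (p := fun s _ =>
    s ∈ Subgroup.closure (gen '' {j | j ≠ 0}) ∨
      gen 0 * s ∈ Subgroup.closure (gen '' {j | j ≠ 0})) (Or.inl (one_mem _)) ?_ ?_ hs
  · rintro _ ⟨j, hj, rfl⟩ y _ hy
    exact key j hj y hy
  · rintro _ ⟨j, hj, rfl⟩ y _ hy
    rw [gen_inv]
    exact key j hj y hy

/-- The first generator as an element of the symmetry group. -/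
noncomputable def genZero : Gam := ⟨gen 0, gen_mem_Gam 0⟩

theorem genZero_mul_genZero : genZero * genZero = 1 :=
  Subtype.ext (mul_inv_cancel (gen 0))

theorem exists_mk_of_adj {u v : Face 0} (h : edgeGraph.Adj u v) :
    ∃ g : Gam, u = QuotientGroup.mk g ∧ v = QuotientGroup.mk (g * genZero) := by
  obtain ⟨hne, e, ⟨g, hgu, hge⟩, ⟨k, hkv, hke⟩⟩ := h
  refine ⟨g, hgu.symm, ?_⟩
  have hs : g⁻¹ * k ∈ faceStab 1 := QuotientGroup.eq.1 (hge.trans hke.symm)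
  rw [faceStab, Subgroup.mem_subgroupOf] at hs
  rcases mem_closure_or_gen_zero_mul_mem_closure hs with h | h
  · refine absurd ?_ hne
    rw [← hgu, ← hkv]
    exact QuotientGroup.eq.2 (Subgroup.mem_subgroupOf.2 h)
  · rw [← hkv, eq_comm]
    refine QuotientGroup.eq.2 (Subgroup.mem_subgroupOf.2 ?_)
    rw [_root_.mul_inv_rev, inv_eq_of_mul_eq_one_left genZero_mul_genZero, mul_assoc]
    exact h

/-- The element `a` of the symmetry group acts as the reflection in the hyperplane of the
root `r`. -/
def IsReflection (a : Gam) (r : Fin 5 → ℝ) : Prop :=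
  ∀ x, a.1.1 *ᵥ x = x - (2 * lor x r) • r

theorem IsReflection.eq {a b : Gam} {r s : Fin 5 → ℝ} (ha : IsReflection a r)
    (hb : IsReflection b s) (h : s = r ∨ s = -r) : a = b := by
  refine Subtype.ext (Units.ext (Matrix.ext_of_mulVec_single fun i => ?_))
  rw [ha, hb]
  rcases h with rfl | rfl
  · rfl
  · rw [lor_neg_right]
    module

theorem gen_zero_mulVec (x : Fin 5 → ℝ) :
    (gen 0).1 *ᵥ x = x - (2 * lor x baseRoot) • baseRoot := by
  change refl 0 *ᵥ x = _
  ext k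
  fin_cases k <;> simp [refl, baseRoot, lor, mulVec, dotProduct, Fin.sum_univ_five]
  ring

theorem isReflection_conj (g : Gam) : IsReflection (g * genZero * g⁻¹) (g.1.1 *ᵥ baseRoot) := by
  intro x
  change (g.1 * gen 0 * g.1⁻¹).1 *ᵥ x = _
  rw [Units.val_mul, Units.val_mul, ← mulVec_mulVec, ← mulVec_mulVec, gen_zero_mulVec,
    mulVec_sub, mulVec_smul, mulVec_inv_mulVec, lor_comm x, lor_mulVec_left g.2, lor_comm]

/-- The endpoints of an edge are exchanged by the reflection in the hyperplane bisecting it. -/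
theorem exists_reflection_of_adj {u v : Face 0} (h : edgeGraph.Adj u v) :
    ∃ (a : Gam) (r : Fin 5 → ℝ), r ∈ roots ∧ IsReflection a r ∧ a • u = v ∧ a • v = u ∧
      point v = point u + (2 : ℝ) • r ∧ lor (point u) r = -1 := by
  obtain ⟨g, rfl, rfl⟩ := exists_mk_of_adj h
  have hneg : g.1.1 *ᵥ (-baseRoot) = (g * genZero).1.1 *ᵥ baseRoot := by
    change _ = (g.1 * gen 0).1 *ᵥ baseRoot
    rw [Units.val_mul, ← mulVec_mulVec, gen_zero_mulVec]
    congr 1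
    ext k
    fin_cases k <;> simp [lor, baseRoot]
    norm_num
  have hl : lor baseVertex baseRoot = 1 := by simp [lor, baseVertex, baseRoot]
  refine ⟨g * genZero * g⁻¹, g.1.1 *ᵥ (-baseRoot), ⟨_, (g * genZero).2, hneg⟩, ?_, ?_, ?_, ?_, ?_⟩
  · intro x
    rw [isReflection_conj g x, mulVec_neg, lor_neg_right]
    module
  · rw [MulAction.Quotient.smul_mk, smul_eq_mul, inv_mul_cancel_right]
  · rw [MulAction.Quotient.smul_mk, smul_eq_mul, mul_assoc, inv_mul_cancel_left, mul_assoc,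
      genZero_mul_genZero, mul_one]
  · rw [point_mk, point_mk]
    change (g.1 * gen 0).1 *ᵥ baseVertex = _
    rw [Units.val_mul, ← mulVec_mulVec, gen_zero_mulVec, hl, mulVec_sub, mulVec_smul, mulVec_neg]
    module
  · rw [point_mk, lor_mulVec g.2, lor_neg_right, hl]

theorem Incident.smul {i j : Fin 5} (a : Gam) {u : Face i} {e : Face j} (h : Incident u e) :
    Incident (a • u) (a • e) := by
  obtain ⟨g, rfl, rfl⟩ := h
  exact ⟨a * g, rfl, rfl⟩

/-- The action of the symmetry group on the graph of vertices and edges. -/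
def smulHom (a : Gam) : edgeGraph →g edgeGraph where
  toFun v := a • v
  map_rel' := by
    rintro u v ⟨hne, e, h1, h2⟩
    exact ⟨fun h => hne (MulAction.injective a h), a • e, h1.smul a, h2.smul a⟩

/-- A path which crosses the same hyperplane in two edges is shortened by reflecting the part
between these edges. -/
theorem exists_shorter_walk {u v : Face 0} (p : edgeGraph.Walk u v) {i j : ℕ} (hij : i < j)
    (a : Gam) (hi : a • p.getVert (i + 1) = p.getVert i)
    (hj : a • p.getVert j = p.getVert (j + 1)) :
    ∃ q : edgeGraph.Walk (p.getVert i) (p.getVert (j + 1)), q.length ≤ j - i - 1 := by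
  have hend : (p.drop (i + 1)).getVert (j - i - 1) = p.getVert j := by
    rw [SimpleGraph.Walk.drop_getVert]
    congr 1
    omega
  refine ⟨(((p.drop (i + 1)).take (j - i - 1)).map (smulHom a)).copy
    (show smulHom a _ = _ from hi) (show smulHom a _ = _ from (congrArg (a • ·) hend).trans hj), ?_⟩
  rw [SimpleGraph.Walk.length_copy, SimpleGraph.Walk.length_map, SimpleGraph.Walk.take_length]
  exact min_le_left _ _

end Tess4335

open Tess4335 in
theorem lemma5p1 (v : Tess4335.Face 0) (loop : Tess4335.edgeGraph.Walk v v)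
    (hloop : 0 < loop.length) :
    ∃ (x y : Tess4335.Face 0) (p : Tess4335.edgeGraph.Walk x y),
      p.IsSubwalk loop ∧ p.length ≤ 8 ∧ ¬ Tess4335.IsMinimal p := by
  by_contra! hmin
  have hlong : 8 < loop.length := by
    by_contra! hle
    have := hmin v v loop loop.isSubwalk_rfl hle SimpleGraph.Walk.nil
    rw [SimpleGraph.Walk.length_nil] at this
    omega
  have hedge : ∀ i, ∃ (a : Gam) (r : Fin 5 → ℝ), i < loop.length →
      r ∈ roots ∧ IsReflection a r ∧ a • loop.getVert i = loop.getVert (i + 1) ∧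
      a • loop.getVert (i + 1) = loop.getVert i ∧
      point (loop.getVert (i + 1)) = point (loop.getVert i) + (2 : ℝ) • r ∧
      lor (point (loop.getVert i)) r = -1 := by
    intro i
    by_cases hi : i < loop.length
    · obtain ⟨a, r, h⟩ := exists_reflection_of_adj (loop.adj_getVert_succ hi)
      exact ⟨a, r, fun _ => h⟩
    · exact ⟨1, 0, fun h => absurd h hi⟩
  choose a n hn using hedge
  have hpath : IsLocalPath (fun i => point (loop.getVert i)) n loop.length := by
    refine ⟨fun i => point_mem_vertexPoints _, fun i hi => (hn i hi).1,
      fun i hi => (hn i hi).2.2.2.2.1, fun i hi => (hn i hi).2.2.2.2.2, fun i j hij hj8 hj => ?_⟩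
    by_contra! hcon
    have hn' : n j = n i ∨ n j = -n i := or_iff_not_imp_left.2 hcon
    have hi : i < loop.length := by omega
    have ha : a i = a j := (hn i hi).2.1.eq (hn j hj).2.1 hn'
    obtain ⟨q, hq⟩ := exists_shorter_walk loop hij (a i) (hn i hi).2.2.2.1
      (by rw [ha]; exact (hn j hj).2.2.1)
    have hend : (loop.drop i).getVert (j + 1 - i) = loop.getVert (j + 1) := by
      rw [SimpleGraph.Walk.drop_getVert]
      congr 1
      omega
    have hlen : ((loop.drop i).take (j + 1 - i)).length = j + 1 - i := by
      rw [SimpleGraph.Walk.take_length, SimpleGraph.Walk.drop_length]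
      omega
    have := hmin _ _ ((loop.drop i).take (j + 1 - i))
      ((SimpleGraph.Walk.isSubwalk_take _ _).trans (SimpleGraph.Walk.isSubwalk_drop _ _))
      (by omega) (q.copy rfl hend.symm)
    rw [SimpleGraph.Walk.length_copy] at this
    omega
  refine hpath.not_closed hlong ?_
  simp
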